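/- An overpartition is a finite (possibly empty) non-increasing sequence of positive integers $\pi=(\pi_1,\ldots,\pi_m)$, called its parts, in which some parts may be overlined, at most one occurrence of each number being overlined: by convention either only the first occurrence or only the last occurrence of a number may be overlined. Let $|\pi|$ be the sum of the sizes of the parts of $\pi$ and $\ell_o(\pi)$ the number of its overlined parts. Let $\overline{\mathcal F}$ (resp. $\overline{\mathcal L}$) be the set of overpartitions in which the first (resp. last) occurrence of a number may be overlined and no two adjacent parts are both overlined. For $r\ge 1$, let $\mathcal F_r$ (resp. $\mathcal L_r$) be the set of overpartitions in which the first (resp. last) occurrence of a number may be overlined and there are no $r$ consecutive parts all of which are non-overlined. Let $(a;q)_n=\prod_{i=0}^{n-1}(1-aq^i)$ and, for integers $k\ge1$, $A$, $B$, let ${A\brack B}_k=\frac{(q^k;q^k)_A}{(q^k;q^k)_B(q^k;q^k)_{A-B}}$ if $A\ge B\ge0$ and ${A\brack B}_k=0$ otherwise. Theorem. Let $z,q\in\mathbb C$ with $|q|<1$, and let $r\geq 1$ be an integer. Then all the series below converge (those indexed by overpartitions absolutely), and \begin{equation*} \sum_{\pi\in\overline{\mathcal{F}}}z^{\ell_o(\pi)}q^{|\pi|}=1+\sum_{m\geq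 1}\sum_{s\geq 0}\frac{z^sq^{m+s^2-s}}{(q;q)_m}{{m-s+1}\brack{s}}_1, \end{equation*} \begin{equation*} \sum_{\pi\in\overline{\mathcal{L}}}z^{\ell_o(\pi)}q^{|\pi|}=1+\sum_{m\geq 1}\sum_{s\geq 0}\frac{z^sq^{m+(s-1)^2}}{(q;q)_m}\left({{m-s}\brack{s-1}}_1+q^{2s-1}{{m-s}\brack{s}}_1\right), \end{equation*} \begin{equation*} \sum_{\pi\in\mathcal{F}_r}z^{\ell_o(\pi)}q^{|\pi|}=1+\sum_{m\geq 1}\sum_{s\geq 0}\frac{z^sq^{m+(s^2-s)/2}}{(q;q)_m}\sum_{i\geq 0}(-1)^iq^{r(i^2-i)/2}{{s+1}\brack {i}}_{r}{{m-ri}\brack {s}}_{1}, \end{equation*} and \begin{equation*} \begin{split} \sum_{\pi\in\mathcal{L}_r}z^{\ell_o(\pi)}q^{|\pi|} =1+\sum_{m\geq 1}\frac{q^m}{(q;q)_m}\Bigg\{{{r-m-1}\brack {0}}_{1}+\sum_{s\geq 1}z^sq^{(s^2-s)/2}\Bigg(&\sum_{i\geq 0}(-1)^iq^{r(i^2-i)/2}{{s}\brack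 {i}}_{r}{{m-ri-1}\brack {s-1}}_{1}\\ &+q^m\sum_{j=1}^{r-1}\sum_{i\geq 0}(-1)^iq^{r(i^2-i)/2-j}{{s}\brack {i}}_{r}{{m-j-ri-1}\brack {s-1}}_{1}\Bigg)\Bigg\}. \end{split} \end{equation*} (At $q=0$, terms in which a negative power of $q$ occurs are read as $0$.) -/

import Mathlib

/-- A part of an overpartition: a natural number, its size, together with a mark telling whether
the part is overlined. -/
structure OverPart where
  size : ℕ
  overlined : Bool

namespace Overpartition

/-- The sequence of parts is a non-increasing sequence of positive integers, once the overlines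
are forgotten. -/
def IsPartition (π : List OverPart) : Prop :=
  (∀ p ∈ π, 0 < p.size) ∧ π.Pairwise (fun a b => b.size ≤ a.size)

/-- Overpartitions in which only the first occurrence of a number may be overlined: an overlined
part differs in size from every earlier part. -/
def IsFirst (π : List OverPart) : Prop :=
  IsPartition π ∧ π.Pairwise (fun a b => b.overlined = true → a.size ≠ b.size)

/-- Overpartitions in which only the last occurrence of a number may be overlined: an overlined
part differs in size from every later part. -/
def IsLast (π : List OverPart) : Prop :=
  IsPartition π ∧ π.Pairwise (fun a b => a.overlined = true → a.size ≠ b.size)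

/-- No two adjacent parts are both overlined. -/
def NoAdjacentOverlined (π : List OverPart) : Prop :=
  π.IsChain (fun a b => ¬ (a.overlined = true ∧ b.overlined = true))

/-- There are no `r` consecutive parts all of which are non-overlined: every block of `r`
consecutive parts contains an overlined part. -/
def NoConsecutiveNonOverlined (r : ℕ) (π : List OverPart) : Prop :=
  ∀ l : List OverPart, l <:+: π → l.length = r → ∃ p ∈ l, p.overlined = true

/-- The weight `|π|`, the sum of the sizes of the parts. -/
def weight (π : List OverPart) : ℕ := (π.map OverPart.size).sum

/-- The number `ℓ_o(π)` of overlined parts. -/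
def numOverlined (π : List OverPart) : ℕ := π.countP OverPart.overlined

def FBar : Set (List OverPart) := {π | IsFirst π ∧ NoAdjacentOverlined π}

def LBar : Set (List OverPart) := {π | IsLast π ∧ NoAdjacentOverlined π}

def FNon (r : ℕ) : Set (List OverPart) := {π | IsFirst π ∧ NoConsecutiveNonOverlined r π}

def LNon (r : ℕ) : Set (List OverPart) := {π | IsLast π ∧ NoConsecutiveNonOverlined r π}

/-- The `q`-shifted factorial `(a; q)_n = (1 - a)(1 - a q) ⋯ (1 - a q ^ (n - 1))`. -/
def qPoch (a q : ℂ) (n : ℕ) : ℂ := ∏ i ∈ Finset.range n, (1 - a * q ^ i)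

/-- The `q`-binomial coefficient in base `q ^ k` for integers `A`, `B`; it is `0` unless
`A ≥ B ≥ 0`. -/
noncomputable def qBinom (q : ℂ) (k : ℕ) (A B : ℤ) : ℂ :=
  if 0 ≤ B ∧ B ≤ A then
    qPoch (q ^ k) (q ^ k) A.toNat /
      (qPoch (q ^ k) (q ^ k) B.toNat * qPoch (q ^ k) (q ^ k) (A - B).toNat)
  else 0

/-- The general term of the generating function of `FBar`. -/
noncomputable def termFBar (z q : ℂ) (m : ℕ+) (s : ℕ) : ℂ :=
  z ^ s * q ^ ((m : ℕ) + (s ^ 2 - s)) / qPoch q q m * qBinom q 1 ((m : ℤ) - s + 1) s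

/-- The general term of the generating function of `LBar`. -/
noncomputable def termLBar (z q : ℂ) (m : ℕ+) (s : ℕ) : ℂ :=
  z ^ s * q ^ ((m : ℤ) + ((s : ℤ) - 1) ^ 2) / qPoch q q m *
    (qBinom q 1 ((m : ℤ) - s) ((s : ℤ) - 1) +
      q ^ (2 * (s : ℤ) - 1) * qBinom q 1 ((m : ℤ) - s) s)

/-- The general term of the generating function of `FNon r`. -/
noncomputable def termFNon (r : ℕ) (z q : ℂ) (m : ℕ+) (s : ℕ) : ℂ :=
  z ^ s * q ^ ((m : ℕ) + (s ^ 2 - s) / 2) / qPoch q q m *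
    ∑' i : ℕ, (-1) ^ i * q ^ (r * ((i ^ 2 - i) / 2)) *
      qBinom q r ((s : ℤ) + 1) i * qBinom q 1 ((m : ℤ) - r * i) s

/-- The general term of the sum over `s ≥ 1` inside the braces in the generating function of
`LNon r`. -/
noncomputable def innerTermLNon (r : ℕ) (z q : ℂ) (m : ℕ+) (s : ℕ+) : ℂ :=
  z ^ (s : ℕ) * q ^ (((s : ℕ) ^ 2 - (s : ℕ)) / 2) *
    ((∑' i : ℕ, (-1) ^ i * q ^ (r * ((i ^ 2 - i) / 2)) *
        qBinom q r s i * qBinom q 1 ((m : ℤ) - r * i - 1) ((s : ℤ) - 1)) +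
      q ^ (m : ℕ) * ∑ j ∈ Finset.Icc 1 (r - 1),
        ∑' i : ℕ, (-1) ^ i * q ^ (((r * ((i ^ 2 - i) / 2) : ℕ) : ℤ) - (j : ℤ)) *
          qBinom q r s i * qBinom q 1 ((m : ℤ) - j - r * i - 1) ((s : ℤ) - 1))

end Overpartition

namespace Overpartition

/-! Fix the word of overline marks of an overpartition with `m` parts. Being an overpartition is
then a lower bound on each difference between neighbouring parts (and on the last part), depending
only on the marks. The excesses over these bounds are free nonnegative integers, so the generating
function for that word is `q ^ minWeight / (q; q)_m` (`hasSum_pow_weight`). Hence each identity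
reduces to a finite one: enumerate binary words of length `m` with `s` letters `true`, subject to
the condition on adjacent letters, by a position statistic.

If first occurrences may be overlined, an overlined part at position `i` (from `0`) raises the `i`
parts before it, so the minimum is `m` plus the sum of the positions. If last occurrences may be, it
raises itself too, except at the very end, where positivity already forces size `1`.

Without adjacent `true` letters, removing the first letter gives a `q`-Pascal recursion
(`wordGF_noAdjacentTrue`). If runs of `false` are shorter than `r`, the `s` letters `true` leave `s
+ 1` gaps, and the series in `x` marking length is `x ^ s * q ^ (s.choose 2) * ∏ j ≤ s, (1 - x ^ r *
q ^ (r * j)) / (1 - x * q ^ j)`. Expanding numerator and denominator by the `q`-binomial theorems,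
in bases `q ^ r` and `q`, explains the alternating sum `gapSum`; the proof checks it through
recursions (`wordGF_noFalseBlock`).

Absolute convergence follows by running the same count with `‖z‖` and `‖q‖` over all words: the term
for `m` parts is then an explicit product, to which the ratio test applies. -/

/-! ### Binary words and the position statistic. -/

/-- The sum of `f` over all words of length `m` in the letters `false` and `true`. -/
def wordSum {R : Type*} [AddCommMonoid R] : ℕ → (List Bool → R) → R
  | 0, f => f []
  | m + 1, f => wordSum m (fun w => f (false :: w)) + wordSum m (fun w => f (true :: w))

theorem wordSum_congr {R : Type*} [AddCommMonoid R] {m : ℕ} {f g : List Bool → R}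
    (h : ∀ w, w.length = m → f w = g w) : wordSum m f = wordSum m g := by
  induction m generalizing f g with
  | zero => exact h [] rfl
  | succ m ih =>
    exact congrArg₂ (· + ·) (ih fun w hw => h _ (by simp [hw])) (ih fun w hw => h _ (by simp [hw]))

theorem wordSum_mul_left {R : Type*} [NonUnitalNonAssocSemiring R] (m : ℕ) (c : R)
    (f : List Bool → R) : wordSum m (fun w => c * f w) = c * wordSum m f := by
  induction m generalizing f with
  | zero => rfl
  | succ m ih => simp only [wordSum, ih, mul_add]

theorem wordSum_zero {R : Type*} [AddCommMonoid R] (m : ℕ) :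
    wordSum m (fun _ => (0 : R)) = 0 := by
  induction m with
  | zero => rfl
  | succ m ih => simp only [wordSum, ih, add_zero]

theorem wordSum_concat {R : Type*} [AddCommMonoid R] (m : ℕ) (f : List Bool → R) :
    wordSum (m + 1) f =
      wordSum m (fun w => f (w ++ [false])) + wordSum m (fun w => f (w ++ [true])) := by
  induction m generalizing f with
  | zero => rfl
  | succ m ih =>
    rw [wordSum, ih, ih]
    simp only [wordSum, List.cons_append]
    abel

/-- The sum of the positions of the letter `true`, counted from `0`. -/
def posSum : List Bool → ℕ
  | [] => 0
  | _ :: w => posSum w + w.count true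

theorem posSum_concat (w : List Bool) (b : Bool) :
    posSum (w ++ [b]) = posSum w + if b then w.length else 0 := by
  induction w with
  | nil => cases b <;> rfl
  | cons a w ih =>
    simp only [List.cons_append, posSum, ih, List.count_append, List.length_cons]
    cases b
    · simp
    · simp
      ring

/-! ### Overpartitions with a prescribed word of overline marks. -/

/-- The size of the first part, `0` for the empty sequence. -/
def headSize : List OverPart → ℕ
  | [] => 0
  | p :: _ => p.size

/-- The word of overline marks. -/
def pattern (π : List OverPart) : List Bool := π.map OverPart.overlined

theorem count_pattern (π : List OverPart) : (pattern π).count true = numOverlined π := by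
  simp [pattern, numOverlined, List.count, List.countP_map, Function.comp_def]

/-- The least possible weight, increased by `k` times the size of the first part, of a sequence
of parts with marks `w`, where a part with mark `b` followed by parts with marks `w` exceeds the
next part at least by `σ b w`. -/
def minWeight (σ : Bool → List Bool → ℕ) : ℕ → List Bool → ℕ
  | _, [] => 0
  | k, b :: w => (k + 1) * σ b w + minWeight σ (k + 1) w

theorem hasSum_mul_of_rclike {𝕜 : Type*} [RCLike 𝕜] {α β : Type*} {f : α → 𝕜} {g : β → 𝕜} {a b : 𝕜}
    (hf : HasSum f a) (hg : HasSum g b) : HasSum (fun x : α × β => f x.1 * g x.2) (a * b) := by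
  have h : Summable fun x : α × β => f x.1 * g x.2 :=
    summable_mul_of_summable_norm (summable_norm_iff.2 hf.summable)
      (summable_norm_iff.2 hg.summable)
  exact hf.mul hg h

/-- The extra weight `k * headSize π` makes the induction close: when the first part is written as
the next part plus a difference, that difference is counted `k + 1` times and the next part inherits
the coefficient `k + 1`. The field is general because `ℝ` serves for convergence and `ℂ` for the
identities. -/
theorem hasSum_pow_weight {𝕜 : Type*} [RCLike 𝕜] {q : 𝕜} (hq : ‖q‖ < 1)
    {σ : Bool → List Bool → ℕ} {C : List OverPart → Prop} [DecidablePred C] (hnil : C [])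
    (hcons : ∀ a π, C (a :: π) ↔ C π ∧ headSize π + σ a.overlined (pattern π) ≤ a.size)
    (m k : ℕ) (g : List Bool → 𝕜) :
    HasSum (fun π : List OverPart =>
        if C π ∧ π.length = m then g (pattern π) * q ^ (weight π + k * headSize π) else 0)
      (wordSum m (fun w => g w * q ^ minWeight σ k w) /
        ∏ j ∈ Finset.range m, (1 - q ^ (k + j + 1))) := by
  induction m generalizing k g with
  | zero =>
    have h := hasSum_single (f := fun π : List OverPart =>
      if C π ∧ π.length = 0 then g (pattern π) * q ^ (weight π + k * headSize π) else 0) []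
      (fun π hπ => if_neg fun h => hπ (List.length_eq_zero_iff.1 h.2))
    simpa [hnil, weight, headSize, pattern, wordSum, minWeight] using h
  | succ m ih =>
    -- The first component is the excess of the new first part over its forced minimum; summing over
    -- it gives the geometric series in `q ^ (k + 1)`.
    let Φ : Bool → ℕ × List OverPart → List OverPart := fun b x =>
      ⟨headSize x.2 + σ b (pattern x.2) + x.1, b⟩ :: x.2
    have hb : ∀ b, HasSum (fun x : ℕ × List OverPart =>
        if C (Φ b x) ∧ (Φ b x).length = m + 1 then
          g (pattern (Φ b x)) * q ^ (weight (Φ b x) + k * headSize (Φ b x)) else 0)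
        (wordSum m (fun w => g (b :: w) * q ^ minWeight σ k (b :: w)) /
          ∏ j ∈ Finset.range (m + 1), (1 - q ^ (k + j + 1))) := by
      intro b
      have hq' : ‖q ^ (k + 1)‖ < 1 := by
        rw [norm_pow]
        exact pow_lt_one₀ (norm_nonneg _) hq (by omega)
      have h1 := hasSum_geometric_of_norm_lt_one hq'
      have h2 := ih (k + 1) (fun w => g (b :: w) * q ^ ((k + 1) * σ b w))
      have h3 := hasSum_mul_of_rclike h1 h2
      convert h3 using 1
      · ext ⟨d, π⟩
        have hc : C (Φ b (d, π)) ↔ C π := by simp [Φ, hcons]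
        simp only [hc, mul_ite, mul_zero, Φ, List.length_cons, Nat.add_right_cancel_iff]
        refine if_congr Iff.rfl ?_ rfl
        simp only [pattern, weight, headSize, List.map_cons, List.sum_cons]
        rw [← pow_mul, mul_assoc, ← pow_add, mul_left_comm, ← pow_add]
        congr 2
        ring
      · rw [Finset.prod_range_succ', inv_mul_eq_div, div_div]
        congr 1
        · exact wordSum_congr fun w _ => by rw [minWeight, pow_add, mul_assoc]
        · congr 1
          refine Finset.prod_congr rfl fun j _ => ?_
          congr 2
          ring
    have hsum := HasSum.sum (f := fun y : (ℕ × List OverPart) ⊕ (ℕ × List OverPart) =>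
        (fun π : List OverPart => if C π ∧ π.length = m + 1 then
          g (pattern π) * q ^ (weight π + k * headSize π) else 0)
          (Sum.elim (Φ false) (Φ true) y)) (hb false) (hb true)
    have hinj : ∀ b, Function.Injective (Φ b) := by
      rintro b ⟨d, π⟩ ⟨d', π'⟩ h
      simp only [Φ, List.cons.injEq, OverPart.mk.injEq] at h
      obtain ⟨h1, rfl⟩ := h
      simp_all
    have hinj' : Function.Injective (Sum.elim (Φ false) (Φ true)) :=
      (hinj false).sumElim (hinj true) fun a b h => by simp [Φ] at h
    rw [wordSum, add_div]
    refine (hinj'.hasSum_iff ?_).1 hsum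
    rintro π hπ
    refine if_neg ?_
    rintro ⟨hC, hl⟩
    obtain _ | ⟨⟨a, b⟩, π⟩ := π
    · simp at hl
    · obtain ⟨d, hd⟩ := Nat.exists_eq_add_of_le ((hcons _ _).1 hC).2
      refine hπ ⟨cond b (Sum.inr (d, π)) (Sum.inl (d, π)), ?_⟩
      cases b <;> simp_all [Φ]

/-! ### Overpartitions as gap conditions, and their minimal weights. -/

/-- The difference forced between a part and the next one when first occurrences may be
overlined. -/
def gapFirst : Bool → List Bool → ℕ
  | _, [] => 1
  | _, c :: _ => c.toNat

/-- The difference forced between a part and the next one when last occurrences may be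
overlined. -/
def gapLast : Bool → List Bool → ℕ
  | _, [] => 1
  | b, _ :: _ => b.toNat

/-- Since sizes do not increase, the pairwise condition reduces to neighbours. For an empty tail,
`headSize` is `0` and the gap is `1`, which encodes positivity of the last part. -/
theorem isFirst_cons (a : OverPart) (π : List OverPart) :
    IsFirst (a :: π) ↔
      IsFirst π ∧ headSize π + gapFirst a.overlined (pattern π) ≤ a.size := by
  obtain _ | ⟨p, π⟩ := π
  · simp [IsFirst, IsPartition, headSize, gapFirst, pattern, Nat.succ_le_iff]
  · have hg : gapFirst a.overlined (pattern (p :: π)) = p.overlined.toNat := rfl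
    rw [hg]
    constructor
    · rintro ⟨⟨h1, h2⟩, h3⟩
      rw [List.pairwise_cons] at h2 h3
      refine ⟨⟨⟨fun x hx => h1 x (List.mem_cons_of_mem _ hx), h2.2⟩, h3.2⟩, ?_⟩
      have h4 := h2.1 p List.mem_cons_self
      have h5 := h3.1 p List.mem_cons_self
      simp only [headSize]
      cases hp : p.overlined <;> simp [hp] at h5 ⊢ <;> omega
    · rintro ⟨⟨⟨h1, h2⟩, h3⟩, h4⟩
      have h5 := h1 p List.mem_cons_self
      simp only [headSize] at h4
      have h2' := List.pairwise_cons.1 h2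
      have h3' := List.pairwise_cons.1 h3
      refine ⟨⟨?_, List.pairwise_cons.2 ⟨?_, h2⟩⟩, List.pairwise_cons.2 ⟨?_, h3⟩⟩
      · rintro x (_ | ⟨_, hx⟩)
        · omega
        · exact h1 x hx
      · rintro x (_ | ⟨_, hx⟩)
        · omega
        · have := h2'.1 x hx
          omega
      · rintro x (_ | ⟨_, hx⟩) ho
        · simp [ho] at h4
          omega
        · have := h2'.1 x hx
          have := h3'.1 x hx ho
          omega

theorem isLast_cons (a : OverPart) (π : List OverPart) :
    IsLast (a :: π) ↔ IsLast π ∧ headSize π + gapLast a.overlined (pattern π) ≤ a.size := by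
  obtain _ | ⟨p, π⟩ := π
  · simp [IsLast, IsPartition, headSize, gapLast, pattern, Nat.succ_le_iff]
  · have hg : gapLast a.overlined (pattern (p :: π)) = a.overlined.toNat := rfl
    rw [hg]
    constructor
    · rintro ⟨⟨h1, h2⟩, h3⟩
      rw [List.pairwise_cons] at h2 h3
      refine ⟨⟨⟨fun x hx => h1 x (List.mem_cons_of_mem _ hx), h2.2⟩, h3.2⟩, ?_⟩
      have h4 := h2.1 p List.mem_cons_self
      have h5 := h3.1 p List.mem_cons_self
      simp only [headSize]
      cases hp : a.overlined <;> simp [hp] at h5 ⊢ <;> omega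
    · rintro ⟨⟨⟨h1, h2⟩, h3⟩, h4⟩
      have h5 := h1 p List.mem_cons_self
      simp only [headSize] at h4
      have h2' := List.pairwise_cons.1 h2
      refine ⟨⟨?_, List.pairwise_cons.2 ⟨?_, h2⟩⟩, List.pairwise_cons.2 ⟨?_, h3⟩⟩
      · rintro x (_ | ⟨_, hx⟩)
        · omega
        · exact h1 x hx
      · rintro x (_ | ⟨_, hx⟩)
        · omega
        · have := h2'.1 x hx
          omega
      · rintro x (_ | ⟨_, hx⟩) ho
        · simp [ho] at h4
          omega
        · have := h2'.1 x hx
          simp [ho] at h4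
          omega

theorem minWeight_gapFirst_cons (k : ℕ) (b : Bool) (w : List Bool) :
    minWeight gapFirst k (b :: w) = w.length + 1 + posSum (b :: w) + k * (1 + w.count true) := by
  induction w generalizing k b with
  | nil => simp [minWeight, gapFirst, posSum]; ring
  | cons c w ih =>
    rw [minWeight, ih]
    cases c <;> simp [gapFirst, posSum] <;> ring

theorem minWeight_gapFirst (w : List Bool) : minWeight gapFirst 0 w = w.length + posSum w := by
  cases w with
  | nil => rfl
  | cons b w => simp [minWeight_gapFirst_cons]

/-- The mark `b` is absent from the right side: the last part has gap `1` whether overlined or not.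
-/
theorem minWeight_gapLast_concat (k : ℕ) (w : List Bool) (b : Bool) :
    minWeight gapLast k (w ++ [b]) =
      w.length + 1 + posSum w + w.count true + k * (1 + w.count true) := by
  induction w generalizing k with
  | nil => simp [minWeight, gapLast, posSum]; ring
  | cons a w ih =>
    have hg : gapLast a (w ++ [b]) = a.toNat := by cases w <;> rfl
    rw [List.cons_append, minWeight, ih, hg]
    cases a <;> simp [posSum] <;> ring

/-- The sum of the positions, counted from `1`, of the letter `true`, the last letter being
disregarded. -/
def posSumLast (w : List Bool) : ℕ := posSum w.dropLast + w.dropLast.count true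

theorem minWeight_gapLast (w : List Bool) :
    minWeight gapLast 0 w = w.length + posSumLast w := by
  induction w using List.reverseRecOn with
  | nil => rfl
  | append_singleton w b => simp [minWeight_gapLast_concat, posSumLast]; ring

/-! ### The `q`-binomial coefficients and their two Pascal rules. -/

theorem qPoch_succ (a q : ℂ) (n : ℕ) : qPoch a q (n + 1) = qPoch a q n * (1 - a * q ^ n) :=
  Finset.prod_range_succ _ _

theorem one_sub_pow_ne_zero {q : ℂ} (hq : ‖q‖ < 1) (n : ℕ) : 1 - q ^ (n + 1) ≠ 0 := by
  intro h
  have h1 : ‖q ^ (n + 1)‖ < 1 := by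
    rw [norm_pow]
    exact pow_lt_one₀ (norm_nonneg _) hq n.succ_ne_zero
  rw [← sub_eq_zero.1 h] at h1
  simp at h1

theorem qPoch_self_ne_zero {q : ℂ} (hq : ‖q‖ < 1) (n : ℕ) : qPoch q q n ≠ 0 :=
  Finset.prod_ne_zero_iff.2 fun i _ => by
    rw [← pow_succ']
    exact one_sub_pow_ne_zero hq i

theorem qBinom_of_lt (q : ℂ) (k : ℕ) {A B : ℤ} (h : A < B) : qBinom q k A B = 0 :=
  if_neg fun h' => absurd h'.2 (not_le.2 h)

theorem qBinom_of_neg (q : ℂ) (k : ℕ) (A : ℤ) {B : ℤ} (h : B < 0) : qBinom q k A B = 0 :=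
  if_neg fun h' => absurd h'.1 (not_le.2 h)

theorem qBinom_add (q : ℂ) (k b d : ℕ) :
    qBinom q k ((b : ℤ) + d) b = qPoch (q ^ k) (q ^ k) (b + d) /
      (qPoch (q ^ k) (q ^ k) b * qPoch (q ^ k) (q ^ k) d) := by
  rw [qBinom, if_pos (by omega)]
  congr 2
  simp

theorem norm_pow_lt_one {q : ℂ} (hq : ‖q‖ < 1) {k : ℕ} (hk : 1 ≤ k) : ‖q ^ k‖ < 1 := by
  rw [norm_pow]
  exact pow_lt_one₀ (norm_nonneg _) hq (by omega)

theorem qBinom_zero_right {q : ℂ} (hq : ‖q‖ < 1) {k : ℕ} (hk : 1 ≤ k) {A : ℤ} (hA : 0 ≤ A) :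
    qBinom q k A 0 = 1 := by
  lift A to ℕ using hA
  have h := qBinom_add q k 0 A
  simp only [Nat.cast_zero, zero_add] at h
  have h0 : qPoch (q ^ k) (q ^ k) 0 = 1 := Finset.prod_range_zero _
  rw [h, h0, one_mul, div_self (qPoch_self_ne_zero (norm_pow_lt_one hq hk) _)]

theorem qBinom_self {q : ℂ} (hq : ‖q‖ < 1) {k : ℕ} (hk : 1 ≤ k) (b : ℕ) :
    qBinom q k b b = 1 := by
  have h := qBinom_add q k b 0
  simp only [Nat.cast_zero, add_zero] at h
  have h0 : qPoch (q ^ k) (q ^ k) 0 = 1 := Finset.prod_range_zero _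
  rw [h, h0, mul_one, div_self (qPoch_self_ne_zero (norm_pow_lt_one hq hk) _)]

/-- Setting the coefficient to `0` outside its range keeps the rule valid for every integer `A`, so
the recursions below need no boundary cases for it. -/
theorem qBinom_succ_succ {q : ℂ} (hq : ‖q‖ < 1) {k : ℕ} (hk : 1 ≤ k) (A : ℤ) (b : ℕ) :
    qBinom q k (A + 1) (b + 1) =
      (q ^ k) ^ (b + 1) * qBinom q k A (b + 1) + qBinom q k A b := by
  rcases lt_trichotomy A b with h | rfl | h
  · rw [qBinom_of_lt _ _ (by omega), qBinom_of_lt _ _ (by omega), qBinom_of_lt _ _ h]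
    simp
  · rw [qBinom_of_lt (A := (b : ℤ)) _ _ (by omega), qBinom_self hq hk]
    have := qBinom_self hq hk (b + 1)
    push_cast at this
    rw [this]
    simp
  · obtain ⟨d, rfl⟩ : ∃ d : ℕ, A = b + 1 + d := ⟨(A - b - 1).toNat, by omega⟩
    have h1 := qBinom_add q k (b + 1) (d + 1)
    have h2 := qBinom_add q k (b + 1) d
    have h3 := qBinom_add q k b (d + 1)
    rw [show b + 1 + (d + 1) = b + d + 1 + 1 by ring] at h1
    rw [show b + 1 + d = b + d + 1 by ring] at h2
    rw [show b + (d + 1) = b + d + 1 by ring] at h3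
    push_cast at h1 h2 h3
    rw [show (b : ℤ) + 1 + d + 1 = b + 1 + (d + 1) by ring, h1, h2,
      show (b : ℤ) + 1 + d = b + (d + 1) by ring, h3]
    have hn := qPoch_self_ne_zero (norm_pow_lt_one hq hk)
    have hb := hn b
    have hd := hn d
    have hb' := hn (b + 1)
    have hd' := hn (d + 1)
    rw [qPoch_succ] at hb' hd'
    rw [qPoch_succ _ _ (b + d + 1), qPoch_succ _ _ b, qPoch_succ _ _ d]
    have e1 := right_ne_zero_of_mul hb'
    have e2 := right_ne_zero_of_mul hd'
    field_simp
    ring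

/-- The truncated exponent `a - b` is harmless: for `a < b` its coefficient vanishes. -/
theorem qBinom_succ_succ' {q : ℂ} (hq : ‖q‖ < 1) {k : ℕ} (hk : 1 ≤ k) (a b : ℕ) :
    qBinom q k ((a : ℤ) + 1) (b + 1) =
      qBinom q k a (b + 1) + (q ^ k) ^ (a - b) * qBinom q k a b := by
  rcases lt_trichotomy a b with h | rfl | h
  · rw [qBinom_of_lt _ _ (by omega), qBinom_of_lt _ _ (by omega), qBinom_of_lt _ _ (by omega)]
    simp
  · rw [qBinom_of_lt (A := (a : ℤ)) _ _ (by omega), qBinom_self hq hk]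
    have := qBinom_self hq hk (a + 1)
    push_cast at this
    rw [this]
    simp
  · obtain ⟨d, rfl⟩ : ∃ d : ℕ, a = b + 1 + d := ⟨a - b - 1, by omega⟩
    have h1 := qBinom_add q k (b + 1) (d + 1)
    have h2 := qBinom_add q k (b + 1) d
    have h3 := qBinom_add q k b (d + 1)
    rw [show b + 1 + (d + 1) = b + d + 1 + 1 by ring] at h1
    rw [show b + 1 + d = b + d + 1 by ring] at h2
    rw [show b + (d + 1) = b + d + 1 by ring] at h3
    push_cast at h1 h2 h3 ⊢
    rw [show (b : ℤ) + 1 + d + 1 = b + 1 + (d + 1) by ring, h1, h2,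
      show (b : ℤ) + 1 + d = b + (d + 1) by ring, h3, show b + 1 + d - b = d + 1 by omega]
    have hn := qPoch_self_ne_zero (norm_pow_lt_one hq hk)
    have hb := hn b
    have hd := hn d
    have hb' := hn (b + 1)
    have hd' := hn (d + 1)
    rw [qPoch_succ] at hb' hd'
    rw [qPoch_succ _ _ (b + d + 1), qPoch_succ _ _ b, qPoch_succ _ _ d]
    have e1 := right_ne_zero_of_mul hb'
    have e2 := right_ne_zero_of_mul hd'
    field_simp
    ring

/-! ### Generating functions of words, and recursions on the first and last letters. -/

open Classical in
/-- The generating function, by the sum of the positions of `true`, of the words of length `m`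
with `s` letters `true` which satisfy `P`. -/
noncomputable def wordGF (P : List Bool → Prop) (q : ℂ) (m s : ℕ) : ℂ :=
  wordSum m fun w => if P w ∧ w.count true = s then q ^ posSum w else 0

open Classical in
/-- The generating function, by `posSumLast`, of the words of length `m` with `s` letters `true`
which satisfy `P`. -/
noncomputable def wordGFLast (P : List Bool → Prop) (q : ℂ) (m s : ℕ) : ℂ :=
  wordSum m fun w => if P w ∧ w.count true = s then q ^ posSumLast w else 0

theorem wordGF_congr {P P' : List Bool → Prop} (h : ∀ w, P w ↔ P' w) :
    wordGF P = wordGF P' := by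
  rw [show P = P' from funext fun w => propext (h w)]

theorem wordGF_zero_left {P : List Bool → Prop} (h : P []) (q : ℂ) (s : ℕ) :
    wordGF P q 0 s = if s = 0 then 1 else 0 := by
  simp [wordGF, wordSum, posSum, h, eq_comm]

theorem wordGF_of_not {P : List Bool → Prop} (h : ∀ w, ¬ P w) (q : ℂ) (m s : ℕ) :
    wordGF P q m s = 0 := by
  simp [wordGF, h, wordSum_zero]

theorem wordGF_zero_succ (P : List Bool → Prop) (q : ℂ) (s : ℕ) :
    wordGF P q 0 (s + 1) = 0 := by
  simp [wordGF, wordSum]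

theorem wordGF_succ_zero (P : List Bool → Prop) (q : ℂ) (m : ℕ) :
    wordGF P q (m + 1) 0 = wordGF (fun w => P (false :: w)) q m 0 := by
  simp only [wordGF, wordSum, posSum, List.count_cons_self, Nat.add_eq_zero_iff, one_ne_zero,
    and_false, if_false, wordSum_zero, add_zero]
  refine wordSum_congr fun w _ => ?_
  by_cases h : List.count true w = 0 <;> by_cases hP : P (false :: w) <;> simp [h, hP]

/-- Prepending a letter moves every later `true` one place to the right. -/
theorem wordGF_succ_succ (P : List Bool → Prop) (q : ℂ) (m s : ℕ) :
    wordGF P q (m + 1) (s + 1) = q ^ (s + 1) * wordGF (fun w => P (false :: w)) q m (s + 1) +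
      q ^ s * wordGF (fun w => P (true :: w)) q m s := by
  simp only [wordGF, wordSum, posSum, ← wordSum_mul_left]
  congr 1
  · refine wordSum_congr fun w _ => ?_
    by_cases h : List.count true w = s + 1 <;> by_cases hP : P (false :: w) <;>
      simp [h, hP, pow_add, mul_comm]
  · refine wordSum_congr fun w _ => ?_
    by_cases h : List.count true w = s <;> by_cases hP : P (true :: w) <;>
      simp [h, hP, pow_add, mul_comm]

theorem wordGF_concat_zero (P : List Bool → Prop) (q : ℂ) (m : ℕ) :
    wordGF P q (m + 1) 0 = wordGF (fun w => P (w ++ [false])) q m 0 := by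
  simp only [wordGF, wordSum_concat, List.count_append, List.count_singleton_self,
    Nat.add_eq_zero_iff, one_ne_zero, and_false, if_false, wordSum_zero, add_zero]
  refine wordSum_congr fun w _ => ?_
  by_cases h : List.count true w = 0 <;> by_cases hP : P (w ++ [false]) <;>
    simp [h, hP, posSum_concat]

theorem wordGF_concat_succ (P : List Bool → Prop) (q : ℂ) (m s : ℕ) :
    wordGF P q (m + 1) (s + 1) = wordGF (fun w => P (w ++ [false])) q m (s + 1) +
      q ^ m * wordGF (fun w => P (w ++ [true])) q m s := by
  simp only [wordGF, wordSum_concat, ← wordSum_mul_left]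
  congr 1
  · refine wordSum_congr fun w _ => ?_
    by_cases h : List.count true w = s + 1 <;> by_cases hP : P (w ++ [false]) <;>
      simp [h, hP, posSum_concat]
  · refine wordSum_congr fun w hw => ?_
    by_cases h : List.count true w = s <;> by_cases hP : P (w ++ [true]) <;>
      simp [h, hP, posSum_concat, pow_add, hw, mul_comm]

theorem wordGFLast_succ_zero (P : List Bool → Prop) (q : ℂ) (m : ℕ) :
    wordGFLast P q (m + 1) 0 = wordGF (fun w => P (w ++ [false])) q m 0 := by
  simp only [wordGF, wordGFLast, wordSum_concat, posSumLast, List.dropLast_concat,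
    List.count_append, List.count_singleton_self, Nat.add_eq_zero_iff, one_ne_zero,
    and_false, if_false, wordSum_zero, add_zero]
  refine wordSum_congr fun w _ => ?_
  by_cases h : List.count true w = 0 <;> by_cases hP : P (w ++ [false]) <;> simp [h, hP]

theorem wordGFLast_succ_succ (P : List Bool → Prop) (q : ℂ) (m s : ℕ) :
    wordGFLast P q (m + 1) (s + 1) =
      q ^ (s + 1) * wordGF (fun w => P (w ++ [false])) q m (s + 1) +
      q ^ s * wordGF (fun w => P (w ++ [true])) q m s := by
  simp only [wordGF, wordGFLast, wordSum_concat, posSumLast, List.dropLast_concat,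
    ← wordSum_mul_left]
  congr 1
  · refine wordSum_congr fun w _ => ?_
    by_cases h : List.count true w = s + 1 <;> by_cases hP : P (w ++ [false]) <;>
      simp [h, hP, pow_add, mul_comm]
  · refine wordSum_congr fun w _ => ?_
    by_cases h : List.count true w = s <;> by_cases hP : P (w ++ [true]) <;>
      simp [h, hP, pow_add, mul_comm]

/-! ### The two conditions on overline marks, as conditions on words. -/

/-- No two adjacent letters are `true`. -/
def NoAdjacentTrue (w : List Bool) : Prop := w.IsChain fun a b => ¬ (a = true ∧ b = true)

theorem noAdjacentOverlined_iff (π : List OverPart) :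
    NoAdjacentOverlined π ↔ NoAdjacentTrue (pattern π) := by
  rw [NoAdjacentTrue, pattern, List.isChain_map]
  rfl

theorem noAdjacentTrue_cons_false (w : List Bool) :
    NoAdjacentTrue (false :: w) ↔ NoAdjacentTrue w := by
  cases w <;> simp [NoAdjacentTrue]

theorem noAdjacentTrue_cons_cons_true (b : Bool) (w : List Bool) :
    NoAdjacentTrue (true :: b :: w) ↔ b = false ∧ NoAdjacentTrue (b :: w) := by
  simp [NoAdjacentTrue]

theorem noAdjacentTrue_reverse (w : List Bool) :
    NoAdjacentTrue w.reverse ↔ NoAdjacentTrue w := by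
  rw [NoAdjacentTrue, List.isChain_reverse, NoAdjacentTrue]
  simp only [and_comm]

theorem noAdjacentTrue_concat_false (w : List Bool) :
    NoAdjacentTrue (w ++ [false]) ↔ NoAdjacentTrue w := by
  rw [← noAdjacentTrue_reverse, List.reverse_append]
  exact (noAdjacentTrue_cons_false _).trans (noAdjacentTrue_reverse w)

theorem noAdjacentTrue_concat_concat_true (w : List Bool) (b : Bool) :
    NoAdjacentTrue (w ++ [b] ++ [true]) ↔ b = false ∧ NoAdjacentTrue (w ++ [b]) := by
  rw [← noAdjacentTrue_reverse, ← noAdjacentTrue_reverse (w ++ [b])]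
  simpa using noAdjacentTrue_cons_cons_true b w.reverse

/-- There are no `r` consecutive letters all of which are `false`. -/
def NoFalseBlock (r : ℕ) (w : List Bool) : Prop :=
  ∀ l : List Bool, l <:+: w → l.length = r → true ∈ l

theorem noConsecutiveNonOverlined_iff (r : ℕ) (π : List OverPart) :
    NoConsecutiveNonOverlined r π ↔ NoFalseBlock r (pattern π) := by
  constructor
  · intro h l hl hr
    obtain ⟨l', hl', rfl⟩ := List.infix_map_iff.1 hl
    obtain ⟨p, hp, ho⟩ := h l' hl' (by simpa using hr)
    exact List.mem_map.2 ⟨p, hp, ho⟩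
  · intro h l hl hr
    obtain ⟨p, hp, ho⟩ := List.mem_map.1 (h _ (hl.map OverPart.overlined) (by simpa using hr))
    exact ⟨p, hp, ho⟩

theorem noFalseBlock_replicate (r j : ℕ) : NoFalseBlock r (List.replicate j false) ↔ j < r := by
  constructor
  · intro h
    by_contra! hj
    have h1 : List.replicate r false <:+: List.replicate j false :=
      ⟨[], List.replicate (j - r) false, by simp [hj]⟩
    simpa using h _ h1 (by simp)
  · intro h l hl hr
    have := hl.length_le
    simp at this
    omega

theorem noFalseBlock_replicate_append (r j : ℕ) (w : List Bool) :
    NoFalseBlock r (List.replicate j false ++ true :: w) ↔ j < r ∧ NoFalseBlock r w := by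
  constructor
  · intro h
    refine ⟨?_, fun l hl => h l (hl.trans ⟨List.replicate j false ++ [true], [], by simp⟩)⟩
    rw [← noFalseBlock_replicate]
    exact fun l hl => h l (hl.trans ⟨[], true :: w, by simp⟩)
  · rintro ⟨hj, hw⟩
    induction j with
    | zero =>
      intro l hl hr
      rcases List.infix_cons_iff.1 hl with h | h
      · cases l with
        | nil => simp at hr; omega
        | cons a l => simp [(List.cons_prefix_cons.1 h).1]
      · exact hw l h hr
    | succ j ih =>
      intro l hl hr
      rw [List.replicate_succ, List.cons_append] at hl
      rcases List.infix_cons_iff.1 hl with h | h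
      -- A block starting at the first letter has length `r > j + 1`, so it reaches the `true`.
      · have h1 : List.replicate (j + 1) false ++ [true] <+: l := by
          refine List.prefix_of_prefix_length_le ?_ h (by simp; omega)
          exact ⟨w, by simp [List.replicate_succ]⟩
        exact h1.subset (by simp)
      · exact ih (by omega) l h hr

theorem noFalseBlock_reverse (r : ℕ) (w : List Bool) :
    NoFalseBlock r w.reverse ↔ NoFalseBlock r w := by
  have key : ∀ w, NoFalseBlock r w → NoFalseBlock r w.reverse := fun w h l hl hr => by
    have := h l.reverse (by rw [← List.reverse_infix, List.reverse_reverse]; exact hl)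
      (by simpa using hr)
    simpa using this
  exact ⟨fun h => by simpa using key _ h, key w⟩

theorem noFalseBlock_append_replicate (r j : ℕ) (w : List Bool) :
    NoFalseBlock r (w ++ [true] ++ List.replicate j false) ↔ j < r ∧ NoFalseBlock r w := by
  rw [← noFalseBlock_reverse, ← noFalseBlock_reverse r w, ← noFalseBlock_replicate_append]
  simp

/-! ### Words without adjacent `true` letters. -/

theorem wordGF_noAdjacentTrue_cons_true (q : ℂ) (m s : ℕ) :
    wordGF (fun w => NoAdjacentTrue (true :: w)) q (m + 1) s =
      q ^ s * wordGF NoAdjacentTrue q m s := by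
  have h : wordGF (fun w => NoAdjacentTrue (true :: false :: w)) = wordGF NoAdjacentTrue :=
    wordGF_congr fun w => by
      simp [noAdjacentTrue_cons_cons_true, noAdjacentTrue_cons_false]
  cases s with
  | zero => rw [wordGF_succ_zero, h, pow_zero, one_mul]
  | succ s =>
    rw [wordGF_succ_succ, h, wordGF_of_not (P := fun w => NoAdjacentTrue (true :: true :: w)),
      mul_zero, add_zero]
    simp [noAdjacentTrue_cons_cons_true]

theorem wordGF_noAdjacentTrue_concat_true (q : ℂ) (m s : ℕ) :
    wordGF (fun w => NoAdjacentTrue (w ++ [true])) q (m + 1) s =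
      wordGF NoAdjacentTrue q m s := by
  have h : wordGF (fun w => NoAdjacentTrue (w ++ [false] ++ [true])) = wordGF NoAdjacentTrue :=
    wordGF_congr fun w => by
      simp only [noAdjacentTrue_concat_concat_true, noAdjacentTrue_concat_false, true_and]
  cases s with
  | zero => rw [wordGF_concat_zero, h]
  | succ s =>
    rw [wordGF_concat_succ, h,
      wordGF_of_not (P := fun w => NoAdjacentTrue (w ++ [true] ++ [true])), mul_zero, add_zero]
    simp only [noAdjacentTrue_concat_concat_true, reduceCtorEq, false_and, not_false_eq_true,
      implies_true]

theorem wordGF_noAdjacentTrue {q : ℂ} (hq : ‖q‖ < 1) :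
    ∀ m s : ℕ, wordGF NoAdjacentTrue q m s =
      q ^ (s ^ 2 - s) * qBinom q 1 ((m : ℤ) - s + 1) s
  | 0, 0 => by
    rw [wordGF_zero_left (by simp [NoAdjacentTrue]), Nat.cast_zero,
      qBinom_zero_right hq le_rfl (by norm_num)]
    simp
  | 0, s + 1 => by
    rw [wordGF_zero_succ, qBinom_of_lt _ _ (by push_cast; omega), mul_zero]
  | m + 1, 0 => by
    rw [wordGF_succ_zero, wordGF_congr noAdjacentTrue_cons_false, wordGF_noAdjacentTrue hq m 0,
      Nat.cast_zero, qBinom_zero_right hq le_rfl (by omega),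
      qBinom_zero_right hq le_rfl (by omega)]
  | 1, s + 1 => by
    rw [wordGF_succ_succ, wordGF_zero_succ, wordGF_zero_left (by simp [NoAdjacentTrue])]
    obtain rfl | hs := Nat.eq_zero_or_pos s
    · have := qBinom_self hq le_rfl 1
      simpa using this.symm
    · rw [qBinom_of_lt _ _ (by push_cast; omega), if_neg (by omega)]
      simp
  -- A leading `true` is followed by a forced `false`; each shifts the other `s` letters `true`,
  -- which accounts for the increase `2 * s` of the exponent.
  | m + 2, s + 1 => by
    have h := qBinom_succ_succ hq le_rfl ((m : ℤ) - s + 1) s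
    rw [wordGF_succ_succ, wordGF_congr noAdjacentTrue_cons_false,
      wordGF_noAdjacentTrue hq (m + 1) (s + 1), wordGF_noAdjacentTrue_cons_true,
      wordGF_noAdjacentTrue hq m s]
    have h1 : (s + 1) ^ 2 - (s + 1) = s ^ 2 - s + 2 * s := by
      have := Nat.le_self_pow two_ne_zero s
      rw [Nat.sub_eq_iff_eq_add (Nat.le_self_pow two_ne_zero _)]
      zify [this]
      ring
    rw [h1]
    push_cast
    rw [show (m : ℤ) + 2 - (s + 1) + 1 = m - s + 1 + 1 by ring, h,
      show (m : ℤ) + 1 - (s + 1) + 1 = m - s + 1 by ring]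
    ring

theorem wordGFLast_noAdjacentTrue_zero {q : ℂ} (hq : ‖q‖ < 1) (m : ℕ) :
    wordGFLast NoAdjacentTrue q (m + 1) 0 = 1 := by
  rw [wordGFLast_succ_zero, wordGF_congr noAdjacentTrue_concat_false, wordGF_noAdjacentTrue hq,
    Nat.cast_zero, qBinom_zero_right hq le_rfl (by omega)]
  simp

/-- The two summands correspond to the last letter being `true` and `false` respectively. -/
theorem wordGFLast_noAdjacentTrue_succ {q : ℂ} (hq : ‖q‖ < 1) (m s : ℕ) :
    wordGFLast NoAdjacentTrue q (m + 1) (s + 1) =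
      q ^ s ^ 2 * (qBinom q 1 ((m : ℤ) - s) s +
        q ^ (2 * s + 1) * qBinom q 1 ((m : ℤ) - s) (s + 1)) := by
  have h1 : (s + 1) + ((s + 1) ^ 2 - (s + 1)) = s ^ 2 + (2 * s + 1) := by
    rw [Nat.add_sub_cancel' (Nat.le_self_pow two_ne_zero _)]
    ring
  rw [wordGFLast_succ_succ, wordGF_congr noAdjacentTrue_concat_false, wordGF_noAdjacentTrue hq,
    ← mul_assoc, ← pow_add, h1]
  push_cast
  rw [show (m : ℤ) - (s + 1) + 1 = m - s by ring]
  have h2 : q ^ s * wordGF (fun w => NoAdjacentTrue (w ++ [true])) q m s =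
      q ^ s ^ 2 * qBinom q 1 ((m : ℤ) - s) s := by
    cases m with
    | zero =>
      rw [wordGF_zero_left (by simp [NoAdjacentTrue])]
      obtain rfl | hs := Nat.eq_zero_or_pos s
      · have := qBinom_self hq le_rfl 0
        simpa using this.symm
      · rw [qBinom_of_lt _ _ (by push_cast; omega), if_neg (by omega)]
        simp
    | succ m =>
      rw [wordGF_noAdjacentTrue_concat_true, wordGF_noAdjacentTrue hq, ← mul_assoc, ← pow_add,
        Nat.add_sub_cancel' (Nat.le_self_pow two_ne_zero _)]
      push_cast
      rw [show (m : ℤ) + 1 - s = m - s + 1 by ring]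
  rw [h2]
  ring

/-! ### Words whose runs of `false` are shorter than `r`. -/

/-- The closed form of the generating function of the words of length `n` with `s` letters
`true` in which no `r` consecutive letters are `false`. -/
noncomputable def gapSum (r : ℕ) (q : ℂ) (n : ℤ) (s : ℕ) : ℂ :=
  q ^ s.choose 2 * ∑ i ∈ Finset.range (s + 2), (-1) ^ i * q ^ (r * i.choose 2) *
    qBinom q r ((s : ℤ) + 1) i * qBinom q 1 (n - r * i) s

theorem gapSum_of_lt (r : ℕ) (q : ℂ) {n : ℤ} {s : ℕ} (h : n < s) : gapSum r q n s = 0 := by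
  rw [gapSum, Finset.sum_eq_zero, mul_zero]
  intro i _
  have : (0 : ℤ) ≤ r * i := by positivity
  rw [qBinom_of_lt _ 1 (by omega), mul_zero]

theorem gapSum_zero_right {q : ℂ} (hq : ‖q‖ < 1) {r : ℕ} (hr : 1 ≤ r) (n : ℕ) :
    gapSum r q n 0 = if n < r then 1 else 0 := by
  have h0 : qBinom q r 1 0 = 1 := qBinom_zero_right hq hr (by norm_num)
  have h1 : qBinom q r 1 1 = 1 := by simpa using qBinom_self hq hr 1
  have h2 : qBinom q 1 n 0 = 1 := qBinom_zero_right hq le_rfl (by omega)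
  simp only [gapSum, Finset.sum_range_succ, Finset.sum_range_zero]
  simp only [Nat.choose_zero_succ, pow_zero, Nat.cast_zero, zero_add, mul_zero, sub_zero, h0, h1,
    h2, Nat.choose_succ_self, Nat.cast_one, mul_one, pow_one, one_mul]
  split_ifs with h
  · rw [qBinom_of_lt _ _ (by omega)]
    simp
  · rw [qBinom_zero_right hq le_rfl (by omega)]
    simp

/-- With `G s` the series of `gapSum` in `x`, this is `(1 - x * q ^ (s + 1)) * G (s + 1) = x * q ^ s
* (1 - x ^ r * q ^ (r * (s + 1))) * G s`. Below, `e1` is Pascal's rule in base `q` and `e2` the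
other Pascal rule in base `q ^ r`. -/
theorem gapSum_succ_succ {q : ℂ} (hq : ‖q‖ < 1) {r : ℕ} (hr : 1 ≤ r) (n : ℤ) (s : ℕ) :
    gapSum r q (n + 1) (s + 1) = q ^ (s + 1) * gapSum r q n (s + 1) +
      q ^ s * (gapSum r q n s - q ^ (r * (s + 1)) * gapSum r q (n - r) s) := by
  let c : ℕ → ℂ := fun i => (-1) ^ i * q ^ (r * i.choose 2)
  have hc : ∀ i, c (i + 1) = -(c i * q ^ (r * i)) := fun i => by
    simp only [c, Nat.choose_succ_succ' i 1, Nat.choose_one_right, mul_add, pow_add]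
    ring
  have hch : (s + 1).choose 2 = s + s.choose 2 := by
    rw [Nat.choose_succ_succ' s 1, Nat.choose_one_right]
  have e1 : ∑ i ∈ Finset.range (s + 3), c i * qBinom q r ((s : ℤ) + 1 + 1) i *
        qBinom q 1 (n + 1 - r * i) (s + 1) =
      q ^ (s + 1) * (∑ i ∈ Finset.range (s + 3), c i * qBinom q r ((s : ℤ) + 1 + 1) i *
        qBinom q 1 (n - r * i) (s + 1)) +
      ∑ i ∈ Finset.range (s + 3), c i * qBinom q r ((s : ℤ) + 1 + 1) i *
        qBinom q 1 (n - r * i) s := by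
    rw [Finset.mul_sum, ← Finset.sum_add_distrib]
    refine Finset.sum_congr rfl fun i _ => ?_
    rw [show n + 1 - r * (i : ℤ) = n - r * i + 1 by ring, qBinom_succ_succ hq le_rfl]
    ring
  have e2 : ∑ i ∈ Finset.range (s + 3), c i * qBinom q r ((s : ℤ) + 1 + 1) i *
        qBinom q 1 (n - r * i) s =
      ∑ i ∈ Finset.range (s + 2), c i * qBinom q r ((s : ℤ) + 1) i * qBinom q 1 (n - r * i) s -
      q ^ (r * (s + 1)) * ∑ i ∈ Finset.range (s + 2), c i * qBinom q r ((s : ℤ) + 1) i *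
        qBinom q 1 (n - r - r * i) s := by
    have e3 : ∑ i ∈ Finset.range (s + 2), c i * qBinom q r ((s : ℤ) + 1) i *
        qBinom q 1 (n - r * i) s = ∑ i ∈ Finset.range (s + 3), c i *
          qBinom q r ((s : ℤ) + 1) i * qBinom q 1 (n - r * i) s := by
      rw [Finset.sum_range_succ _ (s + 2), qBinom_of_lt q r (by push_cast; omega)]
      simp
    rw [e3, Finset.sum_range_succ' _ (s + 2), Finset.sum_range_succ' _ (s + 2), Finset.mul_sum,
      add_sub_right_comm, ← Finset.sum_sub_distrib]
    congr 1
    · refine Finset.sum_congr rfl fun i hi => ?_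
      have h1 := qBinom_succ_succ' hq hr (s + 1) i
      push_cast at h1 ⊢
      have h2 : r * (s + 1) = r * i + r * (s + 1 - i) := by
        rw [← mul_add, Nat.add_sub_cancel' (by simp at hi; omega)]
      rw [h1, hc, show n - r * ((i : ℤ) + 1) = n - r - r * i by ring, h2, pow_add, ← pow_mul]
      ring
    · rw [Nat.cast_zero, qBinom_zero_right hq hr (by omega), qBinom_zero_right hq hr (by omega)]
  simp only [gapSum]
  push_cast
  rw [e1, e2, hch, pow_add]
  ring

theorem wordGF_replicate_zero {r : ℕ} (q : ℂ) (m j : ℕ) :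
    wordGF (fun w => NoFalseBlock r (List.replicate j false ++ w)) q m 0 =
      if m + j < r then 1 else 0 := by
  induction m generalizing j with
  | zero =>
    by_cases h : j < r
    · rw [wordGF_zero_left (by simpa [noFalseBlock_replicate] using h)]
      simp [h]
    · simp [wordGF, wordSum, noFalseBlock_replicate, h]
  | succ m ih =>
    rw [wordGF_succ_zero]
    have := ih (j + 1)
    rw [List.replicate_succ'] at this
    simp only [List.append_assoc, List.singleton_append] at this
    rw [this]
    exact if_congr (by omega) rfl rfl

/-- Split at the first `true`: `t` is the length of the initial run of `false`, including the `j`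
letters prepended. The other `t - j` letters each shift `s + 1` letters `true`, and the first `true`
shifts the remaining `s`. -/
theorem wordGF_replicate_succ {r : ℕ} {q : ℂ} {s : ℕ}
    (hs : ∀ m, wordGF (NoFalseBlock r) q m s = gapSum r q m s) (m j : ℕ) :
    wordGF (fun w => NoFalseBlock r (List.replicate j false ++ w)) q m (s + 1) =
      ∑ t ∈ Finset.Ico j r, q ^ ((t - j) * (s + 1) + s) *
        gapSum r q ((m : ℤ) + j - t - 1) s := by
  induction m generalizing j with
  | zero =>
    rw [wordGF_zero_succ, Finset.sum_eq_zero]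
    intro t ht
    rw [gapSum_of_lt _ _ (by simp at ht ⊢; omega), mul_zero]
  | succ m ih =>
    have h := ih (j + 1)
    rw [List.replicate_succ'] at h
    simp only [List.append_assoc, List.singleton_append] at h
    rw [wordGF_succ_succ, h, wordGF_congr fun w => noFalseBlock_replicate_append r j w]
    by_cases hj : j < r
    · simp only [hj, true_and]
      rw [hs, Finset.sum_eq_sum_Ico_succ_bot hj, Finset.mul_sum, add_comm]
      congr 1
      · simp
      · refine Finset.sum_congr rfl fun t ht => ?_
        obtain ⟨d, rfl⟩ := Nat.exists_eq_add_of_le (Finset.mem_Ico.1 ht).1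
        rw [← mul_assoc, ← pow_add]
        congr 2
        · rw [Nat.add_sub_cancel_left, show j + 1 + d - j = d + 1 by omega]
          ring
        · push_cast
          ring
    · rw [wordGF_of_not (fun w h => hj h.1), Finset.Ico_eq_empty (by omega),
        Finset.Ico_eq_empty (by omega)]
      simp

theorem gapSum_eq_sum {q : ℂ} (hq : ‖q‖ < 1) {r : ℕ} (hr : 1 ≤ r) (m s : ℕ) :
    gapSum r q m (s + 1) =
      ∑ t ∈ Finset.range r, q ^ (t * (s + 1) + s) * gapSum r q ((m : ℤ) - t - 1) s := by
  induction m with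
  | zero =>
    rw [gapSum_of_lt _ _ (by push_cast; omega), Finset.sum_eq_zero]
    intro t _
    rw [gapSum_of_lt _ _ (by push_cast; omega), mul_zero]
  | succ m ih =>
    -- The bracket in `gapSum_succ_succ` is the difference of the extreme terms of this sequence, at
    -- `t = 0` and `t = r`, so it telescopes.
    have h := Finset.sum_range_sub' (fun t : ℕ => q ^ (t * (s + 1) + s) *
      gapSum r q ((m : ℤ) - t) s) r
    rw [Finset.sum_sub_distrib, sub_eq_iff_eq_add] at h
    push_cast
    rw [gapSum_succ_succ hq hr, ih, Finset.mul_sum]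
    have h1 : ∀ t : ℕ, (m : ℤ) + 1 - t - 1 = m - t := fun t => by ring
    simp only [h1]
    rw [h, add_comm]
    congr 1
    · simp [pow_add]
      ring
    · refine Finset.sum_congr rfl fun t _ => ?_
      push_cast
      rw [show (m : ℤ) - (t + 1) = m - t - 1 by ring, ← mul_assoc, ← pow_add]
      congr 2
      ring

theorem wordGF_noFalseBlock {q : ℂ} (hq : ‖q‖ < 1) {r : ℕ} (hr : 1 ≤ r) (m s : ℕ) :
    wordGF (NoFalseBlock r) q m s = gapSum r q m s := by
  induction s generalizing m with
  | zero =>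
    rw [gapSum_zero_right hq hr]
    exact wordGF_replicate_zero q m 0
  | succ s ih =>
    have h := wordGF_replicate_succ ih m 0
    simp only [Nat.sub_zero, Nat.cast_zero, add_zero, ← Finset.range_eq_Ico] at h
    rw [gapSum_eq_sum hq hr, ← h]
    rfl

theorem wordGF_append_replicate_zero {r : ℕ} (q : ℂ) (m j : ℕ) :
    wordGF (fun w => NoFalseBlock r (w ++ List.replicate j false)) q m 0 =
      if m + j < r then 1 else 0 := by
  induction m generalizing j with
  | zero =>
    by_cases h : j < r
    · rw [wordGF_zero_left (by simpa [noFalseBlock_replicate] using h)]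
      simp [h]
    · simp [wordGF, wordSum, noFalseBlock_replicate, h]
  | succ m ih =>
    rw [wordGF_concat_zero]
    have := ih (j + 1)
    rw [List.replicate_succ] at this
    simp only [List.append_assoc, List.singleton_append]
    rw [this]
    exact if_congr (by omega) rfl rfl

/-- Split at the last `true`, which is followed by `t` letters `false` and so sits at position `m +
j - t - 1`. When this integer is negative, `gapSum` vanishes. -/
theorem wordGF_append_replicate_succ {q : ℂ} (hq : ‖q‖ < 1) {r : ℕ} (hr : 1 ≤ r)
    (m j s : ℕ) :
    wordGF (fun w => NoFalseBlock r (w ++ List.replicate j false)) q m (s + 1) =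
      ∑ t ∈ Finset.Ico j r, q ^ ((m : ℤ) + j - t - 1) *
        gapSum r q ((m : ℤ) + j - t - 1) s := by
  induction m generalizing j with
  | zero =>
    rw [wordGF_zero_succ, Finset.sum_eq_zero]
    intro t ht
    rw [gapSum_of_lt _ _ (by simp at ht ⊢; omega), mul_zero]
  | succ m ih =>
    have h := ih (j + 1)
    rw [List.replicate_succ] at h
    rw [wordGF_concat_succ, wordGF_congr fun w => noFalseBlock_append_replicate r j w]
    simp only [List.append_assoc, List.singleton_append]
    rw [h]
    by_cases hj : j < r
    · simp only [hj, true_and]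
      rw [wordGF_noFalseBlock hq hr, Finset.sum_eq_sum_Ico_succ_bot hj, add_comm]
      congr 1
      · have e : ((m + 1 : ℕ) : ℤ) + j - j - 1 = m := by push_cast; ring
        rw [e, zpow_natCast]
      · refine Finset.sum_congr rfl fun t ht => ?_
        have e : ((m + 1 : ℕ) : ℤ) + j - t - 1 = m + (j + 1 : ℕ) - t - 1 := by push_cast; ring
        rw [e]
    · rw [wordGF_of_not (fun w h => hj h.1), Finset.Ico_eq_empty (by omega),
        Finset.Ico_eq_empty (by omega)]
      simp

/-! ### Absolute convergence and summation over overpartitions. -/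

theorem wordSum_pow_posSum {R : Type*} [CommSemiring R] (z q : R) (m : ℕ) :
    wordSum m (fun w => z ^ w.count true * q ^ posSum w) =
      ∏ i ∈ Finset.range m, (1 + z * q ^ i) := by
  induction m with
  | zero => simp [wordSum, posSum]
  | succ m ih =>
    rw [wordSum_concat, Finset.prod_range_succ, ← ih, mul_comm, add_mul, one_mul,
      ← wordSum_mul_left]
    congr 1
    · exact wordSum_congr fun w _ => by simp [posSum_concat]
    · refine wordSum_congr fun w hw => ?_
      simp only [List.count_append, List.count_singleton_self, pow_add, pow_one, posSum_concat,
        if_true, hw]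
      ring

theorem wordSum_pow_minWeight_gapFirst {R : Type*} [CommSemiring R] (z q : R) (m : ℕ) :
    wordSum m (fun w => z ^ w.count true * q ^ minWeight gapFirst 0 w) =
      q ^ m * ∏ i ∈ Finset.range m, (1 + z * q ^ i) := by
  rw [← wordSum_pow_posSum, ← wordSum_mul_left]
  refine wordSum_congr fun w hw => ?_
  rw [minWeight_gapFirst, hw, pow_add]
  ring

/-- The same product as for `gapFirst`: the last mark is free and gives `1 + z`, while the mark at
position `i` before it costs `i + 1`. -/
theorem wordSum_pow_minWeight_gapLast {R : Type*} [CommSemiring R] (z q : R) (m : ℕ) :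
    wordSum m (fun w => z ^ w.count true * q ^ minWeight gapLast 0 w) =
      q ^ m * ∏ i ∈ Finset.range m, (1 + z * q ^ i) := by
  cases m with
  | zero => simp [wordSum, minWeight]
  | succ m =>
    have h := wordSum_pow_posSum (z * q) q m
    simp only [mul_assoc z q, ← pow_succ'] at h
    rw [Finset.prod_range_succ', ← h, wordSum_concat, pow_zero, mul_one, mul_add, mul_add, mul_one,
      mul_comm _ z, mul_left_comm _ z, ← wordSum_mul_left, ← wordSum_mul_left]
    congr 1
    · refine wordSum_congr fun w hw => ?_
      rw [minWeight_gapLast, posSumLast, List.dropLast_concat]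
      simp [hw, pow_add, mul_pow]
      ring
    · refine wordSum_congr fun w hw => ?_
      rw [minWeight_gapLast, posSumLast, List.dropLast_concat]
      simp [hw, pow_add, mul_pow]
      ring

theorem summable_pow_mul_prod_div_prod {z q : ℝ} (hz : 0 ≤ z) (hq0 : 0 ≤ q) (hq : q < 1) :
    Summable fun m : ℕ => (q ^ m * ∏ i ∈ Finset.range m, (1 + z * q ^ i)) /
      ∏ j ∈ Finset.range m, (1 - q ^ (0 + j + 1)) := by
  -- Ratio of consecutive terms; its limit `q` is below `1`.
  have hlim : Filter.Tendsto (fun m : ℕ => q * (1 + z * q ^ m) / (1 - q ^ (0 + m + 1)))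
      Filter.atTop (nhds q) := by
    have h := tendsto_pow_atTop_nhds_zero_of_lt_one hq0 hq
    have h1 : Filter.Tendsto (fun m : ℕ => q ^ (0 + m + 1)) Filter.atTop (nhds 0) := by
      simpa using (Filter.tendsto_add_atTop_iff_nat 1).2 h
    have h2 := (((h.const_mul z).const_add 1).const_mul q).div (h1.const_sub 1) (by norm_num)
    simpa [Pi.div_def] using h2
  obtain ⟨c, hqc, hc⟩ := exists_between hq
  refine summable_of_ratio_norm_eventually_le hc ?_
  filter_upwards [hlim.eventually (gt_mem_nhds hqc)] with m hm
  rw [Finset.prod_range_succ, Finset.prod_range_succ, pow_succ,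
    show ∀ a b c d e f : ℝ, a * b * (c * d) / (e * f) = b * d / f * (a * c / e) from
      fun a b c d e f => by simp only [div_eq_mul_inv, mul_inv]; ring, norm_mul]
  refine mul_le_mul_of_nonneg_right ?_ (norm_nonneg _)
  have h1 : 0 ≤ q * (1 + z * q ^ m) / (1 - q ^ (0 + m + 1)) := by
    have := pow_le_one₀ (n := 0 + m + 1) hq0 hq.le
    exact div_nonneg (by positivity) (by linarith)
  rw [Real.norm_of_nonneg h1]
  exact hm.le

section

variable {σ : Bool → List Bool → ℕ} {C : List OverPart → Prop}

open Classical in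
theorem summable_pow_numOverlined_mul_pow_weight (z : ℂ) {q : ℂ} (hq : ‖q‖ < 1) (hnil : C [])
    (hcons : ∀ a π, C (a :: π) ↔ C π ∧ headSize π + σ a.overlined (pattern π) ≤ a.size)
    (hσ : ∀ m, wordSum m (fun w => ‖z‖ ^ w.count true * ‖q‖ ^ minWeight σ 0 w) =
      ‖q‖ ^ m * ∏ i ∈ Finset.range m, (1 + ‖z‖ * ‖q‖ ^ i)) :
    Summable fun π : List OverPart =>
      if C π then z ^ numOverlined π * q ^ weight π else 0 := by
  let F : ℕ × List OverPart → ℝ := fun x => if C x.2 ∧ x.2.length = x.1 then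
    ‖z‖ ^ (pattern x.2).count true * ‖q‖ ^ (weight x.2 + 0 * headSize x.2) else 0
  have hF := fun m => hasSum_pow_weight (q := ‖q‖) (by simpa using hq) hnil hcons m 0
    (fun w => ‖z‖ ^ w.count true)
  have hF0 : 0 ≤ F := fun x => by
    simp only [F]
    split_ifs
    · positivity
    · exact le_rfl
  have hsum : Summable F := by
    refine (summable_prod_of_nonneg hF0).2 ⟨fun m => (hF m).summable, ?_⟩
    simp only [F, fun m => (hF m).tsum_eq, hσ]
    exact summable_pow_mul_prod_div_prod (norm_nonneg z) (norm_nonneg q) hq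
  have hinj : Function.Injective fun π : List OverPart => (π.length, π) :=
    fun π π' h => (Prod.ext_iff.1 h).2
  refine Summable.of_norm ((hsum.comp_injective hinj).congr fun π => ?_)
  by_cases h : C π <;> simp [F, h, count_pattern]

open Classical in
theorem summable_and_hasSum_length_numOverlined (z : ℂ) {q : ℂ} (hq : ‖q‖ < 1) (hnil : C [])
    (hcons : ∀ a π, C (a :: π) ↔ C π ∧ headSize π + σ a.overlined (pattern π) ≤ a.size)
    (hσ : ∀ m, wordSum m (fun w => ‖z‖ ^ w.count true * ‖q‖ ^ minWeight σ 0 w) =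
      ‖q‖ ^ m * ∏ i ∈ Finset.range m, (1 + ‖z‖ * ‖q‖ ^ i))
    {P : List Bool → Prop} {S : Set (List OverPart)} (hS : ∀ π, π ∈ S ↔ C π ∧ P (pattern π)) :
    Summable (fun π : S => z ^ numOverlined π.1 * q ^ weight π.1) ∧
      HasSum (fun p : ℕ × ℕ => z ^ p.2 * wordSum p.1 (fun w =>
        if P w ∧ w.count true = p.2 then q ^ minWeight σ 0 w else 0) / qPoch q q p.1)
        (∑' π : S, z ^ numOverlined π.1 * q ^ weight π.1) := by
  have hsum : Summable (fun π : S => z ^ numOverlined π.1 * q ^ weight π.1) := by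
    refine ((summable_pow_numOverlined_mul_pow_weight z hq hnil hcons hσ).comp_injective
      Subtype.val_injective).congr fun π => ?_
    simp [((hS π.1).1 π.2).1]
  refine ⟨hsum, ?_⟩
  -- The series over `S` is spread over triples, supported where `(m, s)` are the numbers of parts
  -- and of overlined parts of `π`; absolute convergence allows summing over each fibre first.
  let F : (ℕ × ℕ) × List OverPart → ℂ := fun x => if C x.2 ∧ x.2.length = x.1.1 then
    (if P (pattern x.2) ∧ (pattern x.2).count true = x.1.2 then z ^ x.1.2 else 0) *
      q ^ (weight x.2 + 0 * headSize x.2) else 0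
  have hinj : Function.Injective fun π : S => ((π.1.length, numOverlined π.1), π.1) :=
    fun π π' h => Subtype.ext (Prod.ext_iff.1 h).2
  have hF : HasSum F (∑' π : S, z ^ numOverlined π.1 * q ^ weight π.1) := by
    refine (hinj.hasSum_iff ?_).1 ?_
    · rintro ⟨⟨m, s⟩, π⟩ hx
      simp only [F]
      split_ifs with h1 h2
      · refine absurd ⟨⟨π, (hS π).2 ⟨h1.1, h2.1⟩⟩, ?_⟩ hx
        simp [h1.2, ← h2.2, count_pattern]
      · rw [zero_mul]
      · rfl
    · convert hsum.hasSum using 1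
      ext π
      simp [F, ((hS π.1).1 π.2).1, ((hS π.1).1 π.2).2, count_pattern]
  refine hF.prod_fiberwise fun p => ?_
  have h := hasSum_pow_weight hq hnil hcons p.1 0
    (fun w => if P w ∧ w.count true = p.2 then z ^ p.2 else 0)
  have h1 : ∏ j ∈ Finset.range p.1, (1 - q ^ (0 + j + 1)) = qPoch q q p.1 :=
    Finset.prod_congr rfl fun j _ => by rw [zero_add, pow_succ']
  have h2 : ∀ w : List Bool, (if P w ∧ w.count true = p.2 then z ^ p.2 else 0) *
      q ^ minWeight σ 0 w =
        z ^ p.2 * if P w ∧ w.count true = p.2 then q ^ minWeight σ 0 w else 0 :=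
    fun w => by split_ifs <;> simp
  simp only [h1, h2, wordSum_mul_left] at h
  exact h

end

/-! ### From word generating functions to double series. -/

theorem tsum_eq_zero_add_tsum_pnat {f : ℕ → ℂ} (hf : Summable f) :
    ∑' n, f n = f 0 + ∑' n : ℕ+, f n := by
  rw [hf.tsum_eq_zero_add, tsum_pnat_eq_tsum_succ (f := f)]

theorem summable_and_eq_one_add_tsum_pnat {T : ℕ × ℕ → ℂ} {a : ℂ} (h : HasSum T a)
    (h0 : ∀ s, T (0, s) = if s = 0 then 1 else 0) :
    Summable (fun p : ℕ+ × ℕ => T (p.1, p.2)) ∧ Summable (fun m : ℕ+ => ∑' s, T (m, s)) ∧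
      (∀ m, Summable fun s => T (m, s)) ∧ a = 1 + ∑' m : ℕ+, ∑' s, T (m, s) := by
  have hs : ∀ m, Summable fun s => T (m, s) := fun m => h.summable.prod_factor m
  have h1 := h.prod_fiberwise fun m => (hs m).hasSum
  refine ⟨h.summable.comp_injective (i := fun p : ℕ+ × ℕ => ((p.1 : ℕ), p.2)) ?_,
    h1.summable.comp_injective PNat.coe_injective, hs, ?_⟩
  · rintro ⟨m, s⟩ ⟨m', s'⟩ h
    simp only [Prod.mk.injEq, PNat.coe_inj] at h
    rw [h.1, h.2]
  · rw [← h1.tsum_eq, tsum_eq_zero_add_tsum_pnat h1.summable]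
    simp [h0]

open Classical in
theorem wordSum_pow_minWeight_gapFirst_eq (P : List Bool → Prop) (q : ℂ) (m s : ℕ) :
    wordSum m (fun w => if P w ∧ w.count true = s then q ^ minWeight gapFirst 0 w else 0) =
      q ^ m * wordGF P q m s := by
  rw [wordGF, ← wordSum_mul_left]
  refine wordSum_congr fun w hw => ?_
  rw [minWeight_gapFirst, hw, pow_add, mul_ite, mul_zero]

open Classical in
theorem wordSum_pow_minWeight_gapLast_eq (P : List Bool → Prop) (q : ℂ) (m s : ℕ) :
    wordSum m (fun w => if P w ∧ w.count true = s then q ^ minWeight gapLast 0 w else 0) =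
      q ^ m * wordGFLast P q m s := by
  rw [wordGFLast, ← wordSum_mul_left]
  refine wordSum_congr fun w hw => ?_
  rw [minWeight_gapLast, hw, pow_add, mul_ite, mul_zero]

theorem wordGFLast_zero_left {P : List Bool → Prop} (h : P []) (q : ℂ) (s : ℕ) :
    wordGFLast P q 0 s = if s = 0 then 1 else 0 := by
  simp [wordGFLast, wordSum, posSumLast, posSum, h, eq_comm]

/-- The expansion of the generating function of overpartitions in which first occurrences may be
overlined, along the number of parts and the number of overlined parts. -/
theorem isFirst_expansion (z : ℂ) {q : ℂ} (hq : ‖q‖ < 1) {P : List Bool → Prop} (hP : P [])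
    {S : Set (List OverPart)} (hS : ∀ π, π ∈ S ↔ IsFirst π ∧ P (pattern π)) {t : ℕ+ → ℕ → ℂ}
    (ht : ∀ m s, t m s = z ^ s * (q ^ (m : ℕ) * wordGF P q m s) / qPoch q q m) :
    Summable (fun π : S => z ^ numOverlined π.1 * q ^ weight π.1) ∧
      Summable (fun p : ℕ+ × ℕ => t p.1 p.2) ∧
      ∑' π : S, z ^ numOverlined π.1 * q ^ weight π.1 = 1 + ∑' m : ℕ+, ∑' s : ℕ, t m s := by
  obtain ⟨h1, h2⟩ := summable_and_hasSum_length_numOverlined z hq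
    (by simp [IsFirst, IsPartition]) isFirst_cons
    (wordSum_pow_minWeight_gapFirst _ _) hS
  simp only [wordSum_pow_minWeight_gapFirst_eq] at h2
  obtain ⟨h3, -, -, h4⟩ := summable_and_eq_one_add_tsum_pnat h2 fun s => by
    rw [wordGF_zero_left hP]
    cases s <;> simp [qPoch]
  simp only [ht]
  exact ⟨h1, h3, h4⟩

/-- The expansion of the generating function of overpartitions in which last occurrences may be
overlined, along the number of parts and the number of overlined parts. -/
theorem isLast_expansion (z : ℂ) {q : ℂ} (hq : ‖q‖ < 1) {P : List Bool → Prop} (hP : P [])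
    {S : Set (List OverPart)} (hS : ∀ π, π ∈ S ↔ IsLast π ∧ P (pattern π)) {t : ℕ → ℕ → ℂ}
    (ht : ∀ m s, t m s = z ^ s * (q ^ (m : ℕ) * wordGFLast P q m s) / qPoch q q m) :
    Summable (fun π : S => z ^ numOverlined π.1 * q ^ weight π.1) ∧
      Summable (fun p : ℕ+ × ℕ => t p.1 p.2) ∧ Summable (fun m : ℕ+ => ∑' s, t m s) ∧
      (∀ m, Summable (t m)) ∧
      ∑' π : S, z ^ numOverlined π.1 * q ^ weight π.1 = 1 + ∑' m : ℕ+, ∑' s : ℕ, t m s := by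
  obtain ⟨h1, h2⟩ := summable_and_hasSum_length_numOverlined z hq
    (by simp [IsLast, IsPartition]) isLast_cons
    (wordSum_pow_minWeight_gapLast _ _) hS
  simp only [wordSum_pow_minWeight_gapLast_eq] at h2
  have h3 := summable_and_eq_one_add_tsum_pnat h2 fun s => by
    rw [wordGFLast_zero_left hP]
    cases s <;> simp [qPoch]
  obtain rfl : t = fun m s => z ^ s * (q ^ (m : ℕ) * wordGFLast P q m s) / qPoch q q m :=
    funext fun m => funext fun s => ht m s
  exact ⟨h1, h3⟩

/-! ### Matching the terms of the four identities. -/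

theorem sq_sub_self_div_two (n : ℕ) : (n ^ 2 - n) / 2 = n.choose 2 := by
  rw [Nat.choose_two_right, sq, Nat.mul_sub_one]

theorem termFBar_eq (z : ℂ) {q : ℂ} (hq : ‖q‖ < 1) (m : ℕ+) (s : ℕ) :
    termFBar z q m s = z ^ s * (q ^ (m : ℕ) * wordGF NoAdjacentTrue q m s) / qPoch q q m := by
  rw [termFBar, wordGF_noAdjacentTrue hq, pow_add]
  ring

theorem termLBar_eq (z : ℂ) {q : ℂ} (hq : ‖q‖ < 1) (m : ℕ+) (s : ℕ) :
    termLBar z q m s =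
      z ^ s * (q ^ (m : ℕ) * wordGFLast NoAdjacentTrue q m s) / qPoch q q m := by
  obtain ⟨n, hn⟩ : ∃ n, (m : ℕ) = n + 1 := ⟨m - 1, by have := m.pos; omega⟩
  rw [termLBar, hn]
  cases s with
  | zero =>
    rw [wordGFLast_noAdjacentTrue_zero hq, Nat.cast_zero, qBinom_of_neg _ _ _ (by norm_num),
      qBinom_zero_right hq le_rfl (by push_cast; omega),
      show ((n + 1 : ℕ) : ℤ) + (0 - 1) ^ 2 = ((n + 2 : ℕ) : ℤ) by push_cast; ring, zpow_natCast]
    -- For `s = 0` the term carries `q ^ (m + 1) * q⁻¹`, which is `q ^ m` for `q ≠ 0`; at `q = 0`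
    -- both sides vanish.
    rcases eq_or_ne q 0 with rfl | h0
    · simp
    · have : (q ^ (2 * (0 : ℤ) - 1)) = q⁻¹ := by norm_num
      rw [this]
      field_simp
      ring
  | succ s =>
    rw [wordGFLast_noAdjacentTrue_succ hq]
    push_cast
    rw [show (n : ℤ) + 1 + (s + 1 - 1) ^ 2 = ((n + 1 + s ^ 2 : ℕ) : ℤ) by push_cast; ring,
      show (2 * ((s : ℤ) + 1) - 1) = ((2 * s + 1 : ℕ) : ℤ) by push_cast; ring, zpow_natCast,
      zpow_natCast, pow_add _ (n + 1), show (n : ℤ) + 1 - (s + 1) = n - s by ring,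
      show (s : ℤ) + 1 - 1 = s by ring]
    ring

theorem tsum_eq_gapSum (r : ℕ) (q : ℂ) (n : ℤ) (s : ℕ) :
    q ^ s.choose 2 * ∑' i : ℕ, (-1) ^ i * q ^ (r * i.choose 2) *
      qBinom q r ((s : ℤ) + 1) i * qBinom q 1 (n - r * i) s = gapSum r q n s := by
  rw [gapSum, tsum_eq_sum]
  intro i hi
  rw [qBinom_of_lt q r (by simp at hi; omega)]
  simp

theorem termFNon_eq (z : ℂ) {q : ℂ} (hq : ‖q‖ < 1) {r : ℕ} (hr : 1 ≤ r) (m : ℕ+) (s : ℕ) :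
    termFNon r z q m s =
      z ^ s * (q ^ (m : ℕ) * wordGF (NoFalseBlock r) q m s) / qPoch q q m := by
  simp only [termFNon, sq_sub_self_div_two]
  rw [wordGF_noFalseBlock hq hr, ← tsum_eq_gapSum, pow_add]
  ring

theorem wordGFLast_noFalseBlock_zero {q : ℂ} (hq : ‖q‖ < 1) {r : ℕ} (m : ℕ+) :
    wordGFLast (NoFalseBlock r) q m 0 = qBinom q 1 ((r : ℤ) - m - 1) 0 := by
  obtain ⟨n, hn⟩ : ∃ n, (m : ℕ) = n + 1 := ⟨m - 1, by have := m.pos; omega⟩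
  rw [hn, wordGFLast_succ_zero]
  have h := wordGF_append_replicate_zero (r := r) q n 1
  rw [List.replicate_one] at h
  rw [h]
  split_ifs with h
  · rw [qBinom_zero_right hq le_rfl (by push_cast; omega)]
  · rw [qBinom_of_lt _ _ (by push_cast; omega)]

/-- The first inner sum comes from words ending in `true`; in the second, `j` is the length of the
final run of `false`. Nonvanishing of `q` allows `q ^ (-j)` to be factored out. -/
theorem innerTermLNon_eq (z : ℂ) {q : ℂ} (hq : ‖q‖ < 1) (hq0 : q ≠ 0) {r : ℕ} (hr : 1 ≤ r)
    (m s : ℕ+) :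
    innerTermLNon r z q m s = z ^ (s : ℕ) * wordGFLast (NoFalseBlock r) q m s := by
  obtain ⟨n, hn⟩ : ∃ n, (m : ℕ) = n + 1 := ⟨m - 1, by have := m.pos; omega⟩
  obtain ⟨k, hk⟩ : ∃ k, (s : ℕ) = k + 1 := ⟨s - 1, by have := s.pos; omega⟩
  have h1 := wordGF_append_replicate_succ hq hr n 1 k
  rw [List.replicate_one] at h1
  have h2 : wordGF (fun w => NoFalseBlock r (w ++ [true])) q n k = gapSum r q n k := by
    rw [← wordGF_noFalseBlock hq hr]
    exact congrFun (congrFun (congrFun (wordGF_congr fun w => by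
      simpa [show 0 < r from hr] using noFalseBlock_append_replicate r 0 w) q) n) k
  simp only [innerTermLNon, sq_sub_self_div_two, hn, hk]
  rw [wordGFLast_succ_succ, h1, h2, ← tsum_eq_gapSum, mul_assoc (z ^ (k + 1)),
    Nat.choose_succ_succ' k 1, Nat.choose_one_right, pow_add q k, mul_add (q ^ k * _),
    mul_assoc (q ^ k)]
  push_cast
  have h0 : ∀ i : ℕ, (n : ℤ) + 1 - r * i - 1 = n - r * i := fun i => by ring
  simp only [h0, add_sub_cancel_right]
  rw [add_comm (q ^ (k + 1) * _)]
  congr 2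
  · simp only [Finset.mul_sum]
    refine Finset.sum_congr (by ext; simp; omega) fun j _ => ?_
    rw [show (n : ℤ) + 1 - j - 1 = n - j by ring, ← tsum_eq_gapSum]
    have h3 : ∀ i : ℕ, (-1) ^ i * q ^ ((r : ℤ) * (i.choose 2 : ℤ) - j) *
        qBinom q r ((k : ℤ) + 1) i * qBinom q 1 ((n : ℤ) + 1 - j - r * i - 1) k =
        q ^ (-(j : ℤ)) * ((-1) ^ i * q ^ (r * i.choose 2) * qBinom q r ((k : ℤ) + 1) i *
          qBinom q 1 ((n : ℤ) - j - r * i) k) := fun i => by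
      rw [show (n : ℤ) + 1 - j - r * i - 1 = n - j - r * i by ring,
        sub_eq_add_neg, zpow_add₀ hq0,
        show (r : ℤ) * (i.choose 2 : ℤ) = ((r * i.choose 2 : ℕ) : ℤ) by push_cast; ring,
        zpow_natCast]
      ring
    simp only [h3, tsum_mul_left]
    rw [sub_eq_add_neg, zpow_add₀ hq0, zpow_natCast]
    ring

theorem innerTermLNon_of_lt (r : ℕ) (z q : ℂ) {m s : ℕ+} (h : m < s) :
    innerTermLNon r z q m s = 0 := by
  have h' : (m : ℕ) < s := h
  have h1 : ∀ i : ℕ, qBinom q 1 ((m : ℤ) - r * i - 1) ((s : ℤ) - 1) = 0 := fun i => by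
    have : (0 : ℤ) ≤ r * i := by positivity
    exact qBinom_of_lt _ _ (by omega)
  have h2 : ∀ j i : ℕ, qBinom q 1 ((m : ℤ) - j - r * i - 1) ((s : ℤ) - 1) = 0 := fun j i => by
    have : (0 : ℤ) ≤ r * i := by positivity
    exact qBinom_of_lt _ _ (by omega)
  simp [innerTermLNon, h1, h2]

theorem summable_innerTermLNon (r : ℕ) (z q : ℂ) (m : ℕ+) :
    Summable fun s : ℕ+ => innerTermLNon r z q m s :=
  summable_of_ne_finset_zero (s := Finset.Icc 1 m) fun s hs =>
    innerTermLNon_of_lt r z q (by simpa using hs)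

theorem tsum_wordGFLast_noFalseBlock (z : ℂ) {q : ℂ} (hq : ‖q‖ < 1) {r : ℕ} (hr : 1 ≤ r)
    (m : ℕ+) (hs : Summable fun s =>
      z ^ s * (q ^ (m : ℕ) * wordGFLast (NoFalseBlock r) q m s) / qPoch q q m) :
    ∑' s, z ^ s * (q ^ (m : ℕ) * wordGFLast (NoFalseBlock r) q m s) / qPoch q q m =
      q ^ (m : ℕ) / qPoch q q m *
        (qBinom q 1 ((r : ℤ) - m - 1) 0 + ∑' s : ℕ+, innerTermLNon r z q m s) := by
  -- At `q = 0` the factor `q ^ m` with `m ≥ 1` kills both sides, whatever value the negative powers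
  -- inside take.
  rcases eq_or_ne q 0 with rfl | h0
  · simp
  · rw [tsum_eq_zero_add_tsum_pnat hs, wordGFLast_noFalseBlock_zero hq, mul_add, ← tsum_mul_left]
    congr 1
    · ring
    · exact tsum_congr fun s => by rw [innerTermLNon_eq z hq h0 hr]; ring

theorem noFalseBlock_nil {r : ℕ} (hr : 1 ≤ r) : NoFalseBlock r [] :=
  (noFalseBlock_replicate r 0).2 hr

end Overpartition
open Overpartition in
theorem mainTheorem3 (z q : ℂ) (hq : ‖q‖ < 1) :
    (Summable (fun π : FBar => z ^ numOverlined π.1 * q ^ weight π.1) ∧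
      Summable (fun p : ℕ+ × ℕ => termFBar z q p.1 p.2) ∧
      ∑' π : FBar, z ^ numOverlined π.1 * q ^ weight π.1 =
        1 + ∑' m : ℕ+, ∑' s : ℕ, termFBar z q m s) ∧
    (Summable (fun π : LBar => z ^ numOverlined π.1 * q ^ weight π.1) ∧
      Summable (fun p : ℕ+ × ℕ => termLBar z q p.1 p.2) ∧
      ∑' π : LBar, z ^ numOverlined π.1 * q ^ weight π.1 =
        1 + ∑' m : ℕ+, ∑' s : ℕ, termLBar z q m s) ∧
    ∀ r : ℕ, 1 ≤ r →
      (Summable (fun π : FNon r => z ^ numOverlined π.1 * q ^ weight π.1) ∧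
        Summable (fun p : ℕ+ × ℕ => termFNon r z q p.1 p.2) ∧
        ∑' π : FNon r, z ^ numOverlined π.1 * q ^ weight π.1 =
          1 + ∑' m : ℕ+, ∑' s : ℕ, termFNon r z q m s) ∧
      (Summable (fun π : LNon r => z ^ numOverlined π.1 * q ^ weight π.1) ∧
        (∀ m : ℕ+, Summable (fun s : ℕ+ => innerTermLNon r z q m s)) ∧
        Summable (fun m : ℕ+ => q ^ (m : ℕ) / qPoch q q m *
          (qBinom q 1 ((r : ℤ) - m - 1) 0 + ∑' s : ℕ+, innerTermLNon r z q m s)) ∧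
        ∑' π : LNon r, z ^ numOverlined π.1 * q ^ weight π.1 =
          1 + ∑' m : ℕ+, q ^ (m : ℕ) / qPoch q q m *
            (qBinom q 1 ((r : ℤ) - m - 1) 0 + ∑' s : ℕ+, innerTermLNon r z q m s)) := by
  refine ⟨?_, ?_, fun r hr => ⟨?_, ?_⟩⟩
  · exact isFirst_expansion z hq (by simp [NoAdjacentTrue])
      (fun π => and_congr_right' (noAdjacentOverlined_iff π)) (termFBar_eq z hq)
  · obtain ⟨h1, h2, -, -, h3⟩ := isLast_expansion z hq (P := NoAdjacentTrue) (S := LBar)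
      (by simp [NoAdjacentTrue]) (fun π => and_congr_right' (noAdjacentOverlined_iff π))
      fun _ _ => rfl
    simp only [termLBar_eq z hq]
    exact ⟨h1, h2, h3⟩
  · exact isFirst_expansion z hq (noFalseBlock_nil hr)
      (fun π => and_congr_right' (noConsecutiveNonOverlined_iff r π)) (termFNon_eq z hq hr)
  · obtain ⟨h1, -, h2, h3, h4⟩ := isLast_expansion z hq (P := NoFalseBlock r) (S := LNon r)
      (noFalseBlock_nil hr) (fun π => and_congr_right' (noConsecutiveNonOverlined_iff r π))
      fun _ _ => rfl
    simp only [fun m : ℕ+ => tsum_wordGFLast_noFalseBlock z hq hr m (h3 m)] at h2 h4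
    exact ⟨h1, summable_innerTermLNon r z q, h2, h4⟩
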